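/- Let $\mathcal H$ be a complex Hilbert space, $U(\mathcal H)$ its unitary group with the operator-norm topology, and let $\mathfrak u_*(\mathcal H)$ be the space of Hermitian trace-class operators on $\mathcal H$ with the topology of the trace norm $\|A\|_1=\operatorname{tr}\sqrt{A^\dagger A}$. Let $\rho\in\mathfrak u_*(\mathcal H)$ have finite rank, let $\mathcal O_\rho=\{U\rho U^\dagger : U\in U(\mathcal H)\}\subset\mathfrak u_*(\mathcal H)$ be its orbit with the subspace topology, and let $U_\rho(\mathcal H)=\{U\in U(\mathcal H) : U\rho U^\dagger=\rho\}$, so that $UU_\rho(\mathcal H)\mapsto U\rho U^\dagger$ is a bijection $U(\mathcal H)/U_\rho(\mathcal H)\to\mathcal O_\rho$, by which the two sets are identified. Let $\lambda_1,\dots,\lambda_k$ be the distinct non-zero eigenvalues of $\rho$ and $\lambda_0=0$. For $\rho'\in\mathcal O_\rho$ let $P_i$ and $Q_i$ be the orthogonal projections onto $\ker(\rho-\lambda_i)$ and $\ker(\rho'-\lambda_i)$, and put $X_{\rho'}=\sum_{i=0}^k Q_iP_i$. Then there is an open neighbourhood $W$ of $\rho$ in $\mathcal O_\rho$ such that for every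 $\rho'\in W$ one has $\sum_{i=0}^k\|P_i-Q_i\|\le\frac12$ and $X_{\rho'}$ is invertible with unitary polar factor $\Phi(\rho')\in U(\mathcal H)$, that is, $X_{\rho'}=\Phi(\rho')\,|X_{\rho'}|$ with $|X_{\rho'}|=\sqrt{X_{\rho'}^\dagger X_{\rho'}}$. The map $\Phi:W\to U(\mathcal H)$ is a topological embedding (a homeomorphism onto its image), and its composition with the canonical projection $U(\mathcal H)\to U(\mathcal H)/U_\rho(\mathcal H)\simeq\mathcal O_\rho$ is the identity of $W$. In consequence, the bijection $\mathcal O_\rho\simeq U(\mathcal H)/U_\rho(\mathcal H)$ is a homeomorphism: the trace-norm topology on $\mathcal O_\rho$ coincides with the quotient topology of $U(\mathcal H)/U_\rho(\mathcal H)$. -/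

import Mathlib

open scoped ENNReal InnerProductSpace

section TraceNorm

variable {H : Type*} [NormedAddCommGroup H] [InnerProductSpace ℂ H] [CompleteSpace H]

/-- `∑ i, ⟪b i, T (b i)⟫ ∈ [0, ∞]`: the trace of a positive operator `T` in the Hilbert basis `b`. -/
noncomputable def posTrace {ι : Type*} (b : HilbertBasis ι ℂ H) (T : H →L[ℂ] H) : ℝ≥0∞ :=
  ∑' i, ENNReal.ofReal (RCLike.re ⟪b i, T (b i)⟫_ℂ)

/-- The trace norm `‖A‖₁ = tr |A|`, `|A| = √(A† A)`, with values in `[0, ∞]`.  The trace is computed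
in some Hilbert basis of `H`; by `traceNorm_eq` below the choice does not matter. -/
noncomputable def traceNorm (A : H →L[ℂ] H) : ℝ≥0∞ :=
  posTrace (exists_hilbertBasis ℂ H).choose_spec.choose (CFC.abs A)

theorem enorm_sq_eq_tsum {H : Type*} [NormedAddCommGroup H] [InnerProductSpace ℂ H]
    {ι : Type*} (b : HilbertBasis ι ℂ H) (x : H) :
    ENNReal.ofReal (‖x‖ ^ 2) = ∑' i, ENNReal.ofReal (‖⟪b i, x⟫_ℂ‖ ^ 2) := by
  have h := b.hasSum_inner_mul_inner x x
  have h2 : HasSum (fun i => ‖⟪b i, x⟫_ℂ‖ ^ 2) (‖x‖ ^ 2) := by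
    have h3 := RCLike.hasSum_re ℂ h
    rw [inner_self_eq_norm_sq (𝕜 := ℂ)] at h3
    refine h3.congr_fun ?_ |> id
    intro i
    rw [inner_mul_symm_re_eq_norm, norm_mul, norm_inner_symm x (b i), sq]
  rw [← h2.tsum_eq, ENNReal.ofReal_tsum_of_nonneg (fun _ => sq_nonneg _) h2.summable]

theorem tsum_adjoint {ι κ : Type*} (b : HilbertBasis ι ℂ H) (c : HilbertBasis κ ℂ H)
    (A : H →L[ℂ] H) :
    ∑' i, ENNReal.ofReal (‖A (b i)‖ ^ 2) = ∑' j, ENNReal.ofReal (‖(star A) (c j)‖ ^ 2) := by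
  simp_rw [enorm_sq_eq_tsum c (A _), enorm_sq_eq_tsum b ((star A) _)]
  rw [ENNReal.tsum_comm]
  congr! 5 with j i
  rw [ContinuousLinearMap.star_eq_adjoint, ContinuousLinearMap.adjoint_inner_right,
    norm_inner_symm]

theorem posTrace_star_mul_self {ι : Type*} (b : HilbertBasis ι ℂ H) (S : H →L[ℂ] H) :
    posTrace b (star S * S) = ∑' i, ENNReal.ofReal (‖S (b i)‖ ^ 2) := by
  unfold posTrace
  congr! 3 with i
  rw [ContinuousLinearMap.star_eq_adjoint, mul_apply_eq_comp,
    ContinuousLinearMap.adjoint_inner_right, inner_self_eq_norm_sq (𝕜 := ℂ)]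

theorem posTrace_conj {ι κ : Type*} (b : HilbertBasis ι ℂ H) (c : HilbertBasis κ ℂ H)
    (U : unitary (H →L[ℂ] H)) (T : H →L[ℂ] H) (hT : 0 ≤ T) :
    posTrace b ((U : H →L[ℂ] H) * T * star (U : H →L[ℂ] H)) = posTrace c T := by
  obtain ⟨S, hS, rfl⟩ : ∃ S : H →L[ℂ] H, star S = S ∧ T = star S * S := by
    refine ⟨CFC.sqrt T, (CFC.sqrt_nonneg T).isSelfAdjoint, ?_⟩
    rw [(CFC.sqrt_nonneg T).isSelfAdjoint.star_eq, CFC.sqrt_mul_sqrt_self T hT]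
  have e : (U : H →L[ℂ] H) * (star S * S) * star (U : H →L[ℂ] H)
      = star (S * star (U : H →L[ℂ] H)) * (S * star (U : H →L[ℂ] H)) := by
    simp [mul_assoc]
  rw [e, posTrace_star_mul_self, posTrace_star_mul_self, tsum_adjoint b c]
  congr! 4 with j
  rw [star_mul, star_star, hS, mul_apply_eq_comp]
  exact Unitary.norm_map U _

theorem cfcAbs_conj (U : unitary (H →L[ℂ] H)) (A : H →L[ℂ] H) :
    CFC.abs ((U : H →L[ℂ] H) * A * star (U : H →L[ℂ] H))
      = (U : H →L[ℂ] H) * CFC.abs A * star (U : H →L[ℂ] H) := by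
  have hU : star (U : H →L[ℂ] H) * (U : H →L[ℂ] H) = 1 := Unitary.coe_star_mul_self U
  refine CFC.sqrt_unique ?_ (star_right_conjugate_nonneg (CFC.abs_nonneg A) _)
  calc (U : H →L[ℂ] H) * CFC.abs A * star (U : H →L[ℂ] H)
        * ((U : H →L[ℂ] H) * CFC.abs A * star (U : H →L[ℂ] H))
      = (U : H →L[ℂ] H) * CFC.abs A * (star (U : H →L[ℂ] H) * (U : H →L[ℂ] H))
        * CFC.abs A * star (U : H →L[ℂ] H) := by noncomm_ring
    _ = (U : H →L[ℂ] H) * (CFC.abs A * CFC.abs A) * star (U : H →L[ℂ] H) := by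
        rw [hU]; noncomm_ring
    _ = (U : H →L[ℂ] H) * (star A * A) * star (U : H →L[ℂ] H) := by rw [CFC.abs_mul_abs]
    _ = (U : H →L[ℂ] H) * star A * (star (U : H →L[ℂ] H) * (U : H →L[ℂ] H)) * A
        * star (U : H →L[ℂ] H) := by rw [hU]; noncomm_ring
    _ = _ := by simp only [star_mul, star_star, mul_assoc]

/-- The trace norm can be computed in any Hilbert basis. -/
theorem traceNorm_eq {ι : Type*} (b : HilbertBasis ι ℂ H) (A : H →L[ℂ] H) :
    traceNorm A = posTrace b (CFC.abs A) := by
  have := posTrace_conj (exists_hilbertBasis ℂ H).choose_spec.choose b 1 (CFC.abs A)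
    (CFC.abs_nonneg A)
  simpa [traceNorm] using this

theorem traceNorm_conj (U : unitary (H →L[ℂ] H)) (A : H →L[ℂ] H) :
    traceNorm ((U : H →L[ℂ] H) * A * star (U : H →L[ℂ] H)) = traceNorm A := by
  unfold traceNorm
  rw [cfcAbs_conj]
  exact posTrace_conj _ _ U _ (CFC.abs_nonneg A)

end TraceNorm

section Predual

variable (H : Type*) [NormedAddCommGroup H] [InnerProductSpace ℂ H] [CompleteSpace H]

/-- The space of Hermitian trace-class operators on `H`, i.e. the predual of the Lie algebra of the
unitary group of `H`. -/
@[ext] structure HermitianTraceClass where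
  toOp : H →L[ℂ] H
  isSelfAdjoint : IsSelfAdjoint toOp
  traceNorm_lt_top : traceNorm toOp < ∞

variable {H}

/-- The topology of the trace norm: a set is open iff it contains a trace-norm ball around each of
its points. -/
instance HermitianTraceClass.instTopologicalSpace : TopologicalSpace (HermitianTraceClass H) where
  IsOpen s := ∀ A ∈ s, ∃ ε : ℝ≥0∞, 0 < ε ∧
    ∀ B : HermitianTraceClass H, traceNorm (B.toOp - A.toOp) < ε → B ∈ s
  isOpen_univ := fun _ _ => ⟨1, one_pos, fun _ _ => trivial⟩
  isOpen_inter := by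
    intro s t hs ht A hA
    obtain ⟨ε, hε, h⟩ := hs A hA.1
    obtain ⟨δ, hδ, h'⟩ := ht A hA.2
    exact ⟨min ε δ, lt_min hε hδ, fun B hB =>
      ⟨h B (hB.trans_le (min_le_left _ _)), h' B (hB.trans_le (min_le_right _ _))⟩⟩
  isOpen_sUnion := by
    intro S hS A hA
    obtain ⟨s, hs, hAs⟩ := hA
    obtain ⟨ε, hε, h⟩ := hS s hs A hAs
    exact ⟨ε, hε, fun B hB => ⟨s, hs, h B hB⟩⟩

/-- The (coadjoint) action `U • A = U A U†` of the unitary group. -/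
noncomputable instance HermitianTraceClass.instMulAction :
    MulAction (unitary (H →L[ℂ] H)) (HermitianTraceClass H) where
  smul U A :=
    { toOp := (U : H →L[ℂ] H) * A.toOp * star (U : H →L[ℂ] H)
      isSelfAdjoint := A.isSelfAdjoint.conjugate _
      traceNorm_lt_top := (traceNorm_conj U A.toOp).trans_lt A.traceNorm_lt_top }
  one_smul A := by
    apply HermitianTraceClass.ext
    change ((1 : unitary (H →L[ℂ] H)) : H →L[ℂ] H) * A.toOp
      * star ((1 : unitary (H →L[ℂ] H)) : H →L[ℂ] H) = A.toOp
    simp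
  mul_smul U V A := by
    apply HermitianTraceClass.ext
    change ((U * V : unitary (H →L[ℂ] H)) : H →L[ℂ] H) * A.toOp
      * star ((U * V : unitary (H →L[ℂ] H)) : H →L[ℂ] H)
      = (U : H →L[ℂ] H) * ((V : H →L[ℂ] H) * A.toOp * star (V : H →L[ℂ] H))
      * star (U : H →L[ℂ] H)
    simp [mul_assoc]

end Predual

section Construction

variable {H : Type*} [NormedAddCommGroup H] [InnerProductSpace ℂ H] [CompleteSpace H]

/-- The orthogonal projection onto the eigenspace `ker (A - μ)` (zero if `μ` is not an
eigenvalue). -/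
noncomputable def spectralProj (A : H →L[ℂ] H) (μ : ℂ) : H →L[ℂ] H :=
  (Module.End.eigenspace (A : H →ₗ[ℂ] H) μ).starProjection

/-- The numbers `λ₀ = 0, λ₁, …, λₖ`: zero together with the eigenvalues of `A`. This is a finite
set when `A` has finite rank. -/
def eigenvaluesWithZero (A : H →L[ℂ] H) : Set ℂ :=
  insert 0 {μ | Module.End.HasEigenvalue (A : H →ₗ[ℂ] H) μ}

theorem eigenvaluesWithZero_finite (A : H →L[ℂ] H)
    [FiniteDimensional ℂ (LinearMap.range (A : H →ₗ[ℂ] H))] :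
    (eigenvaluesWithZero A).Finite := by
  let f : Module.End ℂ H := (A : H →ₗ[ℂ] H)
  let B : Module.End ℂ (LinearMap.range f) :=
    f.restrict (p := LinearMap.range f) (q := LinearMap.range f)
      (fun x _ => LinearMap.mem_range_self f x)
  have hB : {μ : ℂ | Module.End.HasEigenvalue B μ}.Finite := by
    have : Finite (Module.End.Eigenvalues B) := inferInstance
    exact Set.finite_coe_iff.mp this
  refine (hB.insert 0).subset ?_
  rintro μ (rfl | hμ)
  · exact Set.mem_insert _ _
  by_cases h0 : μ = 0
  · exact Or.inl h0
  refine Or.inr ?_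
  obtain ⟨v, hv⟩ := Module.End.HasEigenvalue.exists_hasEigenvector hμ
  have hfv : f v = μ • v := hv.apply_eq_smul
  have hmem : v ∈ LinearMap.range f := ⟨μ⁻¹ • v, by rw [map_smul, hfv, inv_smul_smul₀ h0]⟩
  refine Module.End.hasEigenvalue_of_hasEigenvector (x := ⟨v, hmem⟩) ⟨?_, ?_⟩
  · rw [Module.End.mem_eigenspace_iff]
    exact Subtype.ext hfv
  · intro h
    exact hv.2 (congrArg Subtype.val h)

/-- `X = ∑ᵢ Qᵢ Pᵢ`, where `Pᵢ`, `Qᵢ` are the orthogonal projections onto the `λᵢ`-eigenspaces of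
`A` and of `B`, and `λᵢ` runs over the eigenvalues of `A` and `0`. -/
noncomputable def projSum (A B : H →L[ℂ] H) : H →L[ℂ] H :=
  ∑ᶠ μ ∈ eigenvaluesWithZero A, spectralProj B μ * spectralProj A μ

/-- `∑ᵢ ‖Pᵢ - Qᵢ‖`, with the same conventions. -/
noncomputable def projDist (A B : H →L[ℂ] H) : ℝ :=
  ∑ᶠ μ ∈ eigenvaluesWithZero A, ‖spectralProj A μ - spectralProj B μ‖

/-- `U` is the unitary factor in the polar decomposition `X = U |X|`, `|X| = √(X† X)`, of the
invertible operator `X`; it is unique, namely `U = X |X|⁻¹`. -/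
def IsPolarUnitary (X : H →L[ℂ] H) (U : unitary (H →L[ℂ] H)) : Prop :=
  IsUnit X ∧ X = (U : H →L[ℂ] H) * CFC.abs X

/-- The canonical bijection from the orbit of `ρ` in the Hermitian trace-class operators (with the
trace-norm topology) onto `U(H) / U_ρ(H)` (with the quotient of the operator-norm topology), which
maps `U ρ U†` to the class of `U`. -/
noncomputable def orbitEquivQuotient (ρ : HermitianTraceClass H) :
    MulAction.orbit (unitary (H →L[ℂ] H)) ρ ≃
      unitary (H →L[ℂ] H) ⧸ MulAction.stabilizer (unitary (H →L[ℂ] H)) ρ :=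
  MulAction.orbitEquivQuotientStabilizer (unitary (H →L[ℂ] H)) ρ

end Construction

/-! ### Comparison of trace norm and operator norm on the orbit. -/

section TraceNormBounds

variable {H : Type*} [NormedAddCommGroup H] [InnerProductSpace ℂ H] [CompleteSpace H]

/-! A difference of two points of the orbit has rank at most `2 * rank ρ`, so trace norm and
operator norm define the same topology there (`isInducing_toOp_orbit`). Since the orbit has constant
spectrum, each `Qᵢ` is one fixed Lagrange polynomial evaluated at `σ`, hence continuous in `σ`
(`spectralProj_eq_aeval_of_mem_orbit`). Thus `X = ∑ Qᵢ Pᵢ` is continuous in `σ`, and `1 - X = ∑ (Pᵢ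
- Qᵢ) Pᵢ` is small near `ρ`, so `X` is invertible there. From `X ρ = σ X` it follows that `ρ`
commutes with `X† X`, hence with `|X|`, so the polar factor also carries `ρ` to `σ`
(`polarUnitary_conj`). The polar factor is therefore a continuous local section of the orbit map `U
↦ U ρ U†`, and an embedding because the orbit map is a continuous left inverse. The section gives
continuity of the bijection onto the quotient at `ρ`; equivariance spreads it over the orbit. The
inverse is continuous by the universal property of the quotient. -/

theorem norm_cfcAbs_apply (A : H →L[ℂ] H) (x : H) : ‖CFC.abs A x‖ = ‖A x‖ := by
  have key : ∀ S : H →L[ℂ] H, ((‖S x‖ : ℂ)) ^ 2 = ⟪x, (star S * S) x⟫_ℂ := fun S => by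
    rw [ContinuousLinearMap.star_eq_adjoint, mul_apply_eq_comp,
      ContinuousLinearMap.adjoint_inner_right, inner_self_eq_norm_sq_to_K]
    rfl
  have h : ((‖CFC.abs A x‖ : ℂ)) ^ 2 = (‖A x‖ : ℂ) ^ 2 := by
    rw [key, key, (CFC.abs_nonneg A).isSelfAdjoint.star_eq, CFC.abs_mul_abs]
  exact (sq_eq_sq₀ (norm_nonneg _) (norm_nonneg _)).1 (by exact_mod_cast h)

/-- The operator norm is bounded by the trace norm. -/
theorem ofReal_norm_le_traceNorm (A : H →L[ℂ] H) : ENNReal.ofReal ‖A‖ ≤ traceNorm A := by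
  rcases eq_or_ne (traceNorm A) ∞ with h | hfin
  · simp [h]
  set S : H →L[ℂ] H := CFC.sqrt (CFC.abs A) with hS
  have hSs : star S = S := (CFC.sqrt_nonneg _).isSelfAdjoint.star_eq
  have hSS : star S * S = CFC.abs A := by
    rw [hSs, CFC.sqrt_mul_sqrt_self _ (CFC.abs_nonneg A)]
  -- A unit vector extends to a Hilbert basis, so `⟪x, |A| x⟫ = ‖S x‖²` is a single term of the
  -- trace.
  have key : ∀ x : H, ‖x‖ = 1 → ENNReal.ofReal (‖S x‖ ^ 2) ≤ traceNorm A := by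
    intro x hx
    have ho : Orthonormal ℂ ((↑) : ({x} : Set H) → H) := by
      refine ⟨fun v => ?_, fun v w h => absurd (Subsingleton.elim v w) h⟩
      rw [Set.mem_singleton_iff.1 v.2, hx]
    obtain ⟨w, b, hw, hb⟩ := ho.exists_hilbertBasis_extension
    rw [traceNorm_eq b, ← hSS, posTrace_star_mul_self, hb]
    exact ENNReal.le_tsum (f := fun i : w => ENNReal.ofReal (‖S i‖ ^ 2))
      ⟨x, hw (Set.mem_singleton x)⟩
  have hbound : ‖S‖ ≤ √(traceNorm A).toReal := by
    refine S.opNorm_le_of_unit_norm (Real.sqrt_nonneg _) fun x hx => ?_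
    exact Real.le_sqrt_of_sq_le ((ENNReal.ofReal_le_iff_le_toReal hfin).1 (key x hx))
  refine ENNReal.ofReal_le_of_le_toReal ?_
  rw [← CFC.norm_abs (a := A), ← hSS, CStarRing.norm_star_mul_self]
  calc ‖S‖ * ‖S‖ ≤ √(traceNorm A).toReal * √(traceNorm A).toReal := by gcongr
    _ = _ := Real.mul_self_sqrt ENNReal.toReal_nonneg

/-- The trace norm of a self-adjoint operator whose range lies in a finite-dimensional subspace. -/
theorem traceNorm_le_finrank_mul_norm {A : H →L[ℂ] H} (hA : IsSelfAdjoint A) (V : Submodule ℂ H)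
    [FiniteDimensional ℂ V] (hV : LinearMap.range (A : H →ₗ[ℂ] H) ≤ V) :
    traceNorm A ≤ Module.finrank ℂ V * ENNReal.ofReal ‖A‖ := by
  classical
  let e := stdOrthonormalBasis ℂ V
  let f : Fin (Module.finrank ℂ V) → H := fun i => e i
  have hf : Orthonormal ℂ f := e.orthonormal.comp_linearIsometry V.subtypeₗᵢ
  obtain ⟨w, b, hw, hb⟩ := hf.toSubtypeRange.exists_hilbertBasis_extension
  -- Basis vectors `e` outside the chosen basis of `V` are orthogonal to `V`, so `‖A e‖² = ⟪A (A e),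
  -- e⟫ = 0`.
  have hker : ∀ i : w, (i : H) ∉ Set.range f → A i = 0 := by
    intro i hi
    have h1 : ∀ j, ⟪f j, (i : H)⟫_ℂ = 0 := fun j => by
      have hne : (⟨f j, hw ⟨j, rfl⟩⟩ : w) ≠ i := fun h => hi ⟨j, congrArg Subtype.val h⟩
      have := b.orthonormal.2 hne
      rwa [hb] at this
    have h2 : ∀ v ∈ V, ⟪v, (i : H)⟫_ℂ = 0 := fun v hv => by
      have h3 := congrArg Subtype.val (e.sum_repr ⟨v, hv⟩)
      simp only [Submodule.coe_sum, Submodule.coe_smul] at h3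
      rw [← h3, sum_inner]
      refine Finset.sum_eq_zero fun j _ => ?_
      rw [inner_smul_left]
      exact mul_eq_zero_of_right _ (h1 j)
    rw [← inner_self_eq_zero (𝕜 := ℂ)]
    have h4 : ⟪A (A i), (i : H)⟫_ℂ = ⟪A i, A i⟫_ℂ := hA.isSymmetric (A i) i
    rw [← h4]
    exact h2 _ (hV ⟨A i, rfl⟩)
  have hle : ∀ i : w, ENNReal.ofReal (RCLike.re ⟪(i : H), CFC.abs A i⟫_ℂ)
      ≤ (Set.range f).indicator (fun _ => ENNReal.ofReal ‖A‖) (i : H) := by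
    intro i
    by_cases hi : (i : H) ∈ Set.range f
    · rw [Set.indicator_of_mem hi]
      refine ENNReal.ofReal_le_ofReal ?_
      have hn : ‖(i : H)‖ = 1 := by simpa [hb] using b.orthonormal.1 i
      calc RCLike.re ⟪(i : H), CFC.abs A i⟫_ℂ ≤ ‖(i : H)‖ * ‖CFC.abs A i‖ := re_inner_le_norm _ _
        _ = ‖A i‖ := by rw [hn, one_mul, norm_cfcAbs_apply]
        _ ≤ ‖A‖ := A.unit_le_opNorm _ hn.le
    · have h0 : CFC.abs A (i : H) = 0 := by
        rw [← norm_eq_zero, norm_cfcAbs_apply, hker i hi, norm_zero]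
      simp [h0]
  rw [traceNorm_eq b]
  unfold posTrace
  rw [hb]
  calc ∑' i : w, ENNReal.ofReal (RCLike.re ⟪(i : H), CFC.abs A i⟫_ℂ)
      ≤ ∑' i : w, (Set.range f).indicator (fun _ => ENNReal.ofReal ‖A‖) (i : H) :=
        ENNReal.tsum_le_tsum hle
    _ ≤ ∑' x : H, (Set.range f).indicator (fun _ => ENNReal.ofReal ‖A‖) x :=
        ENNReal.tsum_comp_le_tsum_of_injective Subtype.val_injective _
    _ = ∑' x : Set.range f, ENNReal.ofReal ‖A‖ := (tsum_subtype _ _).symm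
    _ = ∑' _ : Fin (Module.finrank ℂ V), ENNReal.ofReal ‖A‖ :=
        (Equiv.ofInjective f hf.linearIndependent.injective).symm.tsum_eq
          (fun _ => ENNReal.ofReal ‖A‖)
    _ = _ := by simp

theorem HermitianTraceClass.continuous_toOp :
    Continuous (HermitianTraceClass.toOp : HermitianTraceClass H → H →L[ℂ] H) := by
  refine continuous_def.2 fun s hs A hA => ?_
  obtain ⟨ε, hε, h⟩ := Metric.isOpen_iff.1 hs _ hA
  refine ⟨ENNReal.ofReal ε, ENNReal.ofReal_pos.2 hε, fun B hB => h ?_⟩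
  rw [Metric.mem_ball, dist_eq_norm]
  exact (ENNReal.ofReal_lt_ofReal_iff hε).1 ((ofReal_norm_le_traceNorm _).trans_lt hB)

theorem HermitianTraceClass.toOp_smul (U : unitary (H →L[ℂ] H)) (A : HermitianTraceClass H) :
    (U • A).toOp = (U : H →L[ℂ] H) * A.toOp * star (U : H →L[ℂ] H) := rfl

/-- The range of `U ρ U† - U' ρ U'†` lies in `U R + U' R` with `R` the range of `ρ`; hence the
factor 2. -/
theorem traceNorm_sub_le_of_mem_orbit (ρ : HermitianTraceClass H)
    [FiniteDimensional ℂ (LinearMap.range (ρ.toOp : H →ₗ[ℂ] H))] {σ τ : HermitianTraceClass H}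
    (hσ : σ ∈ MulAction.orbit (unitary (H →L[ℂ] H)) ρ)
    (hτ : τ ∈ MulAction.orbit (unitary (H →L[ℂ] H)) ρ) :
    traceNorm (σ.toOp - τ.toOp)
      ≤ (2 * Module.finrank ℂ (LinearMap.range (ρ.toOp : H →ₗ[ℂ] H)) : ℕ)
        * ENNReal.ofReal ‖σ.toOp - τ.toOp‖ := by
  obtain ⟨U, rfl⟩ := hσ
  obtain ⟨U', rfl⟩ := hτ
  set R := LinearMap.range (ρ.toOp : H →ₗ[ℂ] H)
  let M : unitary (H →L[ℂ] H) → Submodule ℂ H := fun V => R.map ((V : H →L[ℂ] H) : H →ₗ[ℂ] H)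
  have hM : ∀ (V : unitary (H →L[ℂ] H)) (x : H), (V • ρ).toOp x ∈ M V := fun V x =>
    ⟨ρ.toOp (star (V : H →L[ℂ] H) x), ⟨_, rfl⟩, rfl⟩
  refine (traceNorm_le_finrank_mul_norm
    ((U • ρ).isSelfAdjoint.sub (U' • ρ).isSelfAdjoint) (M U ⊔ M U') ?_).trans ?_
  · rintro _ ⟨x, rfl⟩
    exact Submodule.sub_mem _ (Submodule.mem_sup_left (hM U x)) (Submodule.mem_sup_right (hM U' x))
  · gcongr
    calc Module.finrank ℂ ↥(M U ⊔ M U') ≤ Module.finrank ℂ (M U) + Module.finrank ℂ (M U') :=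
          Submodule.finrank_add_le_finrank_add_finrank _ _
      _ ≤ Module.finrank ℂ R + Module.finrank ℂ R :=
          add_le_add (Submodule.finrank_map_le _ _) (Submodule.finrank_map_le _ _)
      _ = _ := (two_mul _).symm

/-- On the orbit of a finite-rank operator, the trace-norm topology is the operator-norm
topology. -/
theorem isInducing_toOp_orbit (ρ : HermitianTraceClass H)
    [FiniteDimensional ℂ (LinearMap.range (ρ.toOp : H →ₗ[ℂ] H))] :
    Topology.IsInducing
      (fun σ : MulAction.orbit (unitary (H →L[ℂ] H)) ρ => σ.1.toOp) := by
  refine Topology.isInducing_iff_nhds.2 fun σ => le_antisymm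
    (HermitianTraceClass.continuous_toOp.comp continuous_subtype_val).continuousAt.le_comap ?_
  intro s hs
  obtain ⟨t, hts, ht, hσt⟩ := mem_nhds_iff.1 hs
  obtain ⟨u, hu, rfl⟩ := isOpen_induced_iff.1 ht
  obtain ⟨ε, hε, h⟩ := hu σ.1 hσt
  set N := 2 * Module.finrank ℂ (LinearMap.range (ρ.toOp : H →ₗ[ℂ] H))
  -- Continuity at `δ = 0` replaces the choice `ε / N`, avoiding the cases `N = 0` and `ε = ∞`.
  obtain ⟨δ, hδ, hδε⟩ : ∃ δ : ℝ, 0 < δ ∧ (N : ℝ≥0∞) * ENNReal.ofReal δ < ε := by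
    have hc : ContinuousAt (fun δ : ℝ => (N : ℝ≥0∞) * ENNReal.ofReal δ) 0 :=
      (ENNReal.continuous_const_mul (ENNReal.natCast_ne_top N)).continuousAt.comp
        ENNReal.continuous_ofReal.continuousAt
    have h0 : ∀ᶠ δ in nhds (0 : ℝ), (N : ℝ≥0∞) * ENNReal.ofReal δ < ε :=
      hc.eventually (gt_mem_nhds (by simpa using hε))
    obtain ⟨δ, h1, h2⟩ := ((h0.filter_mono nhdsWithin_le_nhds).and
      (self_mem_nhdsWithin (s := Set.Ioi (0 : ℝ)))).exists
    exact ⟨δ, h2, h1⟩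
  refine Filter.mem_comap.2 ⟨Metric.ball σ.1.toOp δ, Metric.ball_mem_nhds _ hδ, fun τ hτ => ?_⟩
  refine hts (h τ.1 ((traceNorm_sub_le_of_mem_orbit ρ τ.2 σ.2).trans_lt (lt_of_le_of_lt ?_ hδε)))
  gcongr
  rw [Set.mem_preimage, Metric.mem_ball, dist_eq_norm] at hτ
  exact hτ.le

end TraceNormBounds

/-- Gives access to the spectral theorem for compact self-adjoint operators. -/
theorem ContinuousLinearMap.isCompactOperator_of_finiteDimensional_range {H : Type*}
    [NormedAddCommGroup H] [InnerProductSpace ℂ H] (A : H →L[ℂ] H)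
    [FiniteDimensional ℂ (LinearMap.range (A : H →ₗ[ℂ] H))] : IsCompactOperator A := by
  let R := LinearMap.range (A : H →ₗ[ℂ] H)
  have : ProperSpace R := FiniteDimensional.proper ℂ R
  let B : H →L[ℂ] R := A.codRestrict R fun x => LinearMap.mem_range_self (A : H →ₗ[ℂ] H) x
  have hB : IsCompactOperator B := isCompactOperator_of_locallyCompactSpace_dom B
  exact hB.clm_comp R.subtypeL

/-! ### Spectral resolution and polynomial formula for the projections. -/

section SpectralProjections

variable {H : Type*} [NormedAddCommGroup H] [InnerProductSpace ℂ H] [CompleteSpace H]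

theorem mul_spectralProj (A : H →L[ℂ] H) (μ : ℂ) : A * spectralProj A μ = μ • spectralProj A μ := by
  ext x
  exact Module.End.mem_eigenspace_iff.1 (Submodule.starProjection_apply_mem _ x)

theorem spectralProj_mul_self (A : H →L[ℂ] H) (μ : ℂ) :
    spectralProj A μ * spectralProj A μ = spectralProj A μ := by
  ext x
  exact Submodule.starProjection_eq_self_iff.2 (Submodule.starProjection_apply_mem _ x)

theorem spectralProj_mul_of_ne {A : H →L[ℂ] H} (hA : IsSelfAdjoint A) {μ ν : ℂ} (h : μ ≠ ν) :
    spectralProj A μ * spectralProj A ν = 0 :=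
  Submodule.starProjection_comp_starProjection_eq_zero_iff.2
    (Submodule.isOrtho_iff_inner_eq.2 fun u hu v hv =>
      hA.isSymmetric.orthogonalFamily_eigenspaces h ⟨u, hu⟩ ⟨v, hv⟩)

variable (A : H →L[ℂ] H) [FiniteDimensional ℂ (LinearMap.range (A : H →ₗ[ℂ] H))]

/-- The eigenvalues of a finite-rank operator together with zero, as a finite set. -/
noncomputable def eigenvalueFinset : Finset ℂ := (eigenvaluesWithZero_finite A).toFinset

theorem coe_eigenvalueFinset : (eigenvalueFinset A : Set ℂ) = eigenvaluesWithZero A :=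
  Set.Finite.coe_toFinset _

theorem spectralProj_eq_zero_of_notMem {μ : ℂ} (h : μ ∉ eigenvalueFinset A) :
    spectralProj A μ = 0 := by
  have hb : Module.End.eigenspace (A : H →ₗ[ℂ] H) μ = ⊥ := by
    by_contra hne
    exact h ((eigenvaluesWithZero_finite A).mem_toFinset.2 (Or.inr hne))
  have hx : ∀ x, spectralProj A μ x ∈ Module.End.eigenspace (A : H →ₗ[ℂ] H) μ := fun x =>
    Submodule.starProjection_apply_mem _ x
  ext x
  simpa [hb] using hx x

/-- Resolution of the identity. -/
theorem sum_spectralProj (hA : IsSelfAdjoint A) :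
    ∑ μ ∈ eigenvalueFinset A, spectralProj A μ = 1 := by
  have hmul : ∀ ν, spectralProj A ν * ∑ μ ∈ eigenvalueFinset A, spectralProj A μ
      = spectralProj A ν := fun ν => by
    rw [Finset.mul_sum, Finset.sum_eq_single ν (fun μ _ h => spectralProj_mul_of_ne hA h.symm)
      (fun h => by rw [spectralProj_eq_zero_of_notMem A h, mul_zero]), spectralProj_mul_self]
  have hbot := ContinuousLinearMap.orthogonalComplement_iSup_eigenspaces_eq_bot
    A.isCompactOperator_of_finiteDimensional_range hA.isSymmetric
  ext x
  -- The residual is killed by every spectral projection, so it is orthogonal to the span of all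
  -- eigenspaces, which is dense.
  have hmem : (1 : H →L[ℂ] H) x - (∑ μ ∈ eigenvalueFinset A, spectralProj A μ) x
      ∈ (⨆ μ, Module.End.eigenspace (A : Module.End ℂ H) μ)ᗮ := by
    rw [← Submodule.iInf_orthogonal, Submodule.mem_iInf]
    intro ν
    have h : spectralProj A ν ((1 : H →L[ℂ] H) x
        - (∑ μ ∈ eigenvalueFinset A, spectralProj A μ) x) = 0 := by
      rw [map_sub, ← mul_apply_eq_comp, ← mul_apply_eq_comp, hmul, mul_one, sub_self]
    exact (Submodule.starProjection_apply_eq_zero_iff _).1 h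
  rw [hbot, Submodule.mem_bot, sub_eq_zero] at hmem
  exact hmem.symm

theorem aeval_eq_sum_spectralProj (hA : IsSelfAdjoint A) (p : Polynomial ℂ) :
    Polynomial.aeval A p = ∑ μ ∈ eigenvalueFinset A, p.eval μ • spectralProj A μ := by
  have h : ∀ μ, Polynomial.aeval A p * spectralProj A μ = p.eval μ • spectralProj A μ := by
    intro μ
    induction p using Polynomial.induction_on' with
    | add p q hp hq => rw [map_add, add_mul, hp, hq, Polynomial.eval_add, add_smul]
    | monomial n a =>
      rw [Polynomial.aeval_monomial, Polynomial.eval_monomial, mul_assoc, mul_smul,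
        ← Algebra.smul_def]
      congr 1
      induction n with
      | zero => simp
      | succ n ih => rw [pow_succ, mul_assoc, mul_spectralProj, mul_smul_comm, ih, smul_smul,
          pow_succ']
  rw [← mul_one (Polynomial.aeval A p), ← sum_spectralProj A hA, Finset.mul_sum]
  exact Finset.sum_congr rfl fun μ _ => h μ

/-- The Lagrange polynomial is 1 at `μ` and 0 at the other nodes, so only one term of the resolution
survives. -/
theorem aeval_lagrange_basis (hA : IsSelfAdjoint A) {μ : ℂ} (hμ : μ ∈ eigenvalueFinset A) :
    Polynomial.aeval A (Lagrange.basis (eigenvalueFinset A) id μ) = spectralProj A μ := by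
  rw [aeval_eq_sum_spectralProj A hA, Finset.sum_eq_single μ]
  · have := Lagrange.eval_basis_self (v := id) Function.injective_id.injOn hμ
    rw [id] at this
    rw [this, one_smul]
  · intro ν hν h
    have := Lagrange.eval_basis_of_ne (v := id) h.symm hν
    rw [id] at this
    rw [this, zero_smul]
  · exact fun h => absurd hμ h

end SpectralProjections

/-! ### Unitary conjugation of projections and polynomials. -/

section Conjugation
variable {H : Type*} [NormedAddCommGroup H] [InnerProductSpace ℂ H] [CompleteSpace H]

/-- `U` carries the `μ`-eigenspace of `A` onto that of `U A U†`; the proof checks membership and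
orthogonality of the residual. -/
theorem spectralProj_conj (U : unitary (H →L[ℂ] H)) (A : H →L[ℂ] H) (μ : ℂ) :
    spectralProj ((U : H →L[ℂ] H) * A * star (U : H →L[ℂ] H)) μ
      = (U : H →L[ℂ] H) * spectralProj A μ * star (U : H →L[ℂ] H) := by
  have hU : star (U : H →L[ℂ] H) * (U : H →L[ℂ] H) = 1 := Unitary.coe_star_mul_self U
  have hU' : (U : H →L[ℂ] H) * star (U : H →L[ℂ] H) = 1 := Unitary.coe_mul_star_self U
  set B := (U : H →L[ℂ] H) * A * star (U : H →L[ℂ] H) with hB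
  have hBU : B * U = U * A := by rw [hB, mul_assoc, hU, mul_one]
  ext x
  refine Submodule.eq_starProjection_of_mem_of_inner_eq_zero ?_ ?_
  · rw [Module.End.mem_eigenspace_iff]
    change (B * (U * spectralProj A μ * star (U : H →L[ℂ] H))) x
      = (μ • (U * spectralProj A μ * star (U : H →L[ℂ] H))) x
    rw [← mul_assoc, ← mul_assoc, hBU, mul_assoc (U : H →L[ℂ] H), mul_spectralProj]
    simp
  · intro w hw
    have hw' : B w = μ • w := Module.End.mem_eigenspace_iff.1 hw
    have hAU : A * star (U : H →L[ℂ] H) = star (U : H →L[ℂ] H) * B := by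
      rw [hB, ← mul_assoc, ← mul_assoc, hU, one_mul]
    have hv : star (U : H →L[ℂ] H) w ∈ Module.End.eigenspace (A : H →ₗ[ℂ] H) μ := by
      rw [Module.End.mem_eigenspace_iff]
      change (A * star (U : H →L[ℂ] H)) w = _
      rw [hAU, mul_apply_eq_comp, hw', map_smul]
    have hx : x - ((U : H →L[ℂ] H) * spectralProj A μ * star (U : H →L[ℂ] H)) x
        = (U : H →L[ℂ] H) (star (U : H →L[ℂ] H) x - spectralProj A μ (star (U : H →L[ℂ] H) x)) := by
      rw [map_sub, ← mul_apply_eq_comp, hU']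
      rfl
    rw [hx, ← ContinuousLinearMap.adjoint_inner_right, ← ContinuousLinearMap.star_eq_adjoint]
    exact Submodule.starProjection_inner_eq_zero _ _ hv

theorem aeval_conj (U : unitary (H →L[ℂ] H)) (A : H →L[ℂ] H) (p : Polynomial ℂ) :
    Polynomial.aeval ((U : H →L[ℂ] H) * A * star (U : H →L[ℂ] H)) p
      = (U : H →L[ℂ] H) * Polynomial.aeval A p * star (U : H →L[ℂ] H) := by
  exact Polynomial.aeval_algHom_apply (Unitary.conjStarAlgAut ℂ (H →L[ℂ] H) U) A p

end Conjugation

/-! ### The polar factor of an invertible operator. -/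

section PolarFactor

variable {H : Type*} [NormedAddCommGroup H] [InnerProductSpace ℂ H] [CompleteSpace H]

theorem isUnit_cfcAbs {X : H →L[ℂ] H} (hX : IsUnit X) : IsUnit (CFC.abs X) := by
  have h : IsUnit (CFC.abs X * CFC.abs X) := by
    rw [CFC.abs_mul_abs]
    exact hX.star.mul hX
  exact ((Commute.refl _).isUnit_mul_iff.1 h).1

theorem mul_inverse_cfcAbs_mem_unitary {X : H →L[ℂ] H} (hX : IsUnit X) :
    X * Ring.inverse (CFC.abs X) ∈ unitary (H →L[ℂ] H) := by
  have hu := isUnit_cfcAbs hX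
  have hs : star (Ring.inverse (CFC.abs X)) = Ring.inverse (CFC.abs X) := by
    rw [← Ring.inverse_star, (CFC.abs_nonneg X).isSelfAdjoint.star_eq]
  have h1 : star (X * Ring.inverse (CFC.abs X)) * (X * Ring.inverse (CFC.abs X)) = 1 := by
    calc star (X * Ring.inverse (CFC.abs X)) * (X * Ring.inverse (CFC.abs X))
        = Ring.inverse (CFC.abs X) * (star X * X) * Ring.inverse (CFC.abs X) := by
          rw [star_mul, hs]; noncomm_ring
      _ = (Ring.inverse (CFC.abs X) * CFC.abs X) * (CFC.abs X * Ring.inverse (CFC.abs X)) := by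
          rw [← CFC.abs_mul_abs]; noncomm_ring
      _ = 1 := by rw [Ring.inverse_mul_cancel _ hu, Ring.mul_inverse_cancel _ hu, one_mul]
  exact (hX.mul hu.ringInverse).mem_unitary_of_star_mul_self h1

/-- The unitary polar factor `X |X|⁻¹` of an invertible operator. -/
noncomputable def polarUnitary (X : H →L[ℂ] H) (hX : IsUnit X) : unitary (H →L[ℂ] H) :=
  ⟨X * Ring.inverse (CFC.abs X), mul_inverse_cfcAbs_mem_unitary hX⟩

theorem isPolarUnitary_polarUnitary {X : H →L[ℂ] H} (hX : IsUnit X) :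
    IsPolarUnitary X (polarUnitary X hX) :=
  ⟨hX, by
    change X = X * Ring.inverse (CFC.abs X) * CFC.abs X
    rw [mul_assoc, Ring.inverse_mul_cancel _ (isUnit_cfcAbs hX), mul_one]⟩

/-- In `X |X|⁻¹` the absolute value is norm-continuous, and inversion is continuous at units. -/
theorem continuous_polarUnitary {T : Type*} [TopologicalSpace T] {f : T → H →L[ℂ] H}
    (hf : Continuous f) (hu : ∀ t, IsUnit (f t)) :
    Continuous fun t => polarUnitary (f t) (hu t) := by
  refine Continuous.subtype_mk (hf.mul (continuous_iff_continuousAt.2 fun t => ?_)) _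
  obtain ⟨u, h⟩ := isUnit_cfcAbs (hu t)
  have hc : ContinuousAt Ring.inverse (CFC.abs (f t)) := h ▸ NormedRing.inverse_continuousAt u
  exact hc.comp (f := fun t => CFC.abs (f t)) (CFC.continuous_abs.comp hf).continuousAt

/-- The unitary polar factor of an invertible intertwiner of self-adjoint operators is an
intertwiner. -/
theorem polarUnitary_conj {X A B : H →L[ℂ] H} (hX : IsUnit X) (hA : IsSelfAdjoint A)
    (hB : IsSelfAdjoint B) (h : X * A = B * X) :
    (polarUnitary X hX : H →L[ℂ] H) * A * star (polarUnitary X hX : H →L[ℂ] H) = B := by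
  have h' : A * star X = star X * B := by
    have := congrArg star h
    rwa [star_mul, star_mul, hA.star_eq, hB.star_eq] at this
  have hc : Commute A (star X * X) := by
    rw [commute_iff_eq, ← mul_assoc, h', mul_assoc, ← h, mul_assoc]
  -- `|X|` is a functional calculus of `X† X`, so it inherits the commutation with `A`.
  have hc' : Commute A (CFC.abs X) := (hc.symm.cfcₙ_nnreal NNReal.sqrt).symm
  have hi : Ring.inverse (CFC.abs X) * A = A * Ring.inverse (CFC.abs X) := by
    obtain ⟨u, hu⟩ := isUnit_cfcAbs hX
    rw [← hu, Ring.inverse_unit]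
    rw [← hu] at hc'
    exact (hc'.units_inv_right).symm.eq
  have hint : (polarUnitary X hX : H →L[ℂ] H) * A = B * (polarUnitary X hX : H →L[ℂ] H) := by
    change X * Ring.inverse (CFC.abs X) * A = B * (X * Ring.inverse (CFC.abs X))
    rw [mul_assoc, hi, ← mul_assoc, h, mul_assoc]
  rw [hint, mul_assoc, Unitary.mul_star_self_of_mem (polarUnitary X hX).2, mul_one]

end PolarFactor

/-! ### Invertibility, intertwining and continuity of `X` on the orbit. -/

section LocalSection

variable {H : Type*} [NormedAddCommGroup H] [InnerProductSpace ℂ H] [CompleteSpace H]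

theorem projSum_eq_sum (A B : H →L[ℂ] H)
    [FiniteDimensional ℂ (LinearMap.range (A : H →ₗ[ℂ] H))] :
    projSum A B = ∑ μ ∈ eigenvalueFinset A, spectralProj B μ * spectralProj A μ := by
  rw [projSum, ← coe_eigenvalueFinset, finsum_mem_coe_finset]

theorem projDist_eq_sum (A B : H →L[ℂ] H)
    [FiniteDimensional ℂ (LinearMap.range (A : H →ₗ[ℂ] H))] :
    projDist A B = ∑ μ ∈ eigenvalueFinset A, ‖spectralProj A μ - spectralProj B μ‖ := by
  rw [projDist, ← coe_eigenvalueFinset, finsum_mem_coe_finset]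

theorem projDist_self (A : H →L[ℂ] H)
    [FiniteDimensional ℂ (LinearMap.range (A : H →ₗ[ℂ] H))] : projDist A A = 0 := by
  simp [projDist_eq_sum]

theorem spectralProj_mul {A : H →L[ℂ] H} (hA : IsSelfAdjoint A)
    [FiniteDimensional ℂ (LinearMap.range (A : H →ₗ[ℂ] H))] (μ : ℂ) :
    spectralProj A μ * A = μ • spectralProj A μ := by
  have h : spectralProj A μ * A = spectralProj A μ * (A * 1) := by rw [mul_one]
  rw [h, ← sum_spectralProj A hA, Finset.mul_sum, Finset.mul_sum]
  simp_rw [mul_spectralProj, mul_smul_comm]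
  rw [Finset.sum_eq_single μ (fun ν _ h => by rw [spectralProj_mul_of_ne hA h.symm, smul_zero])
    (fun h => by rw [spectralProj_eq_zero_of_notMem A h, mul_zero, smul_zero]),
    spectralProj_mul_self]

/-- Termwise, both sides equal `μ • Q P`. -/
theorem projSum_mul {A : H →L[ℂ] H} (B : H →L[ℂ] H) (hA : IsSelfAdjoint A)
    [FiniteDimensional ℂ (LinearMap.range (A : H →ₗ[ℂ] H))] :
    projSum A B * A = B * projSum A B := by
  rw [projSum_eq_sum, Finset.sum_mul, Finset.mul_sum]
  refine Finset.sum_congr rfl fun μ _ => ?_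
  rw [mul_assoc, spectralProj_mul hA, ← mul_assoc, mul_spectralProj, mul_smul_comm, smul_mul_assoc]

theorem norm_projSum_sub_one_le {A : H →L[ℂ] H} (B : H →L[ℂ] H) (hA : IsSelfAdjoint A)
    [FiniteDimensional ℂ (LinearMap.range (A : H →ₗ[ℂ] H))] :
    ‖1 - projSum A B‖ ≤ projDist A B := by
  have h : 1 - projSum A B = ∑ μ ∈ eigenvalueFinset A,
      (spectralProj A μ - spectralProj B μ) * spectralProj A μ := by
    simp_rw [sub_mul, spectralProj_mul_self, Finset.sum_sub_distrib]
    rw [sum_spectralProj A hA, projSum_eq_sum]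
  rw [h, projDist_eq_sum]
  refine norm_sum_le_of_le _ fun μ _ => (norm_mul_le _ _).trans ?_
  exact mul_le_of_le_one_right (norm_nonneg _) (Submodule.starProjection_norm_le _)

theorem isUnit_projSum {A B : H →L[ℂ] H} (hA : IsSelfAdjoint A)
    [FiniteDimensional ℂ (LinearMap.range (A : H →ₗ[ℂ] H))] (h : projDist A B < 1) :
    IsUnit (projSum A B) := by
  have := isUnit_one_sub_of_norm_lt_one ((norm_projSum_sub_one_le B hA).trans_lt h)
  rwa [sub_sub_cancel] at this

variable (ρ : HermitianTraceClass H)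

theorem orbitEquivQuotient_smul (U : unitary (H →L[ℂ] H))
    (σ : MulAction.orbit (unitary (H →L[ℂ] H)) ρ) :
    orbitEquivQuotient ρ (U • σ) = U • orbitEquivQuotient ρ σ := by
  obtain ⟨q, rfl⟩ := (orbitEquivQuotient ρ).symm.surjective σ
  rw [Equiv.apply_symm_apply, ← Equiv.eq_symm_apply]
  induction q using QuotientGroup.induction_on with
  | H V => exact Subtype.ext (mul_smul U V ρ).symm

theorem mk_eq_orbitEquivQuotient {U : unitary (H →L[ℂ] H)}
    {σ : MulAction.orbit (unitary (H →L[ℂ] H)) ρ} (h : U • ρ = σ.1) :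
    (QuotientGroup.mk U : unitary (H →L[ℂ] H) ⧸ MulAction.stabilizer (unitary (H →L[ℂ] H)) ρ)
      = orbitEquivQuotient ρ σ := by
  rw [← Equiv.symm_apply_eq]
  exact Subtype.ext h

variable [FiniteDimensional ℂ (LinearMap.range (ρ.toOp : H →ₗ[ℂ] H))]

/-- The polynomial depends on `ρ` alone, so continuity in `σ` is that of polynomial evaluation. -/
theorem spectralProj_eq_aeval_of_mem_orbit {σ : HermitianTraceClass H}
    (hσ : σ ∈ MulAction.orbit (unitary (H →L[ℂ] H)) ρ) {μ : ℂ}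
    (hμ : μ ∈ eigenvalueFinset ρ.toOp) :
    spectralProj σ.toOp μ
      = Polynomial.aeval σ.toOp (Lagrange.basis (eigenvalueFinset ρ.toOp) id μ) := by
  obtain ⟨U, rfl⟩ := hσ
  change spectralProj (U • ρ).toOp μ = Polynomial.aeval (U • ρ).toOp _
  rw [HermitianTraceClass.toOp_smul, spectralProj_conj, aeval_conj,
    aeval_lagrange_basis _ ρ.isSelfAdjoint hμ]

theorem continuous_toOp_orbit :
    Continuous fun σ : MulAction.orbit (unitary (H →L[ℂ] H)) ρ => σ.1.toOp :=
  (isInducing_toOp_orbit ρ).continuous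

theorem continuous_spectralProj_orbit {μ : ℂ} (hμ : μ ∈ eigenvalueFinset ρ.toOp) :
    Continuous fun σ : MulAction.orbit (unitary (H →L[ℂ] H)) ρ => spectralProj σ.1.toOp μ := by
  simp_rw [fun σ : MulAction.orbit (unitary (H →L[ℂ] H)) ρ =>
    spectralProj_eq_aeval_of_mem_orbit ρ σ.2 hμ]
  exact (Polynomial.continuous_aeval _).comp (continuous_toOp_orbit ρ)

theorem continuous_projSum_orbit :
    Continuous fun σ : MulAction.orbit (unitary (H →L[ℂ] H)) ρ => projSum ρ.toOp σ.1.toOp := by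
  simp_rw [projSum_eq_sum]
  exact continuous_finsetSum _ fun μ hμ => (continuous_spectralProj_orbit ρ hμ).mul continuous_const

theorem continuous_projDist_orbit :
    Continuous fun σ : MulAction.orbit (unitary (H →L[ℂ] H)) ρ => projDist ρ.toOp σ.1.toOp := by
  simp_rw [projDist_eq_sum]
  exact continuous_finsetSum _ fun μ hμ =>
    (continuous_const.sub (continuous_spectralProj_orbit ρ hμ)).norm

theorem continuous_smul_orbit :
    Continuous fun p : unitary (H →L[ℂ] H) × MulAction.orbit (unitary (H →L[ℂ] H)) ρ =>
      p.1 • p.2 := by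
  refine (isInducing_toOp_orbit ρ).continuous_iff.2 ?_
  have h1 : Continuous fun p : unitary (H →L[ℂ] H) × MulAction.orbit (unitary (H →L[ℂ] H)) ρ =>
      (p.1 : H →L[ℂ] H) := continuous_subtype_val.comp continuous_fst
  exact (h1.mul ((continuous_toOp_orbit ρ).comp continuous_snd)).mul h1.star

theorem continuous_orbitEquivQuotient_symm : Continuous (orbitEquivQuotient ρ).symm := by
  refine (QuotientGroup.isQuotientMap_mk _).continuous_iff.2 ?_
  exact (continuous_smul_orbit ρ).comp
    (Continuous.prodMk continuous_id (continuous_const (y := ⟨ρ, MulAction.mem_orbit_self ρ⟩)))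

end LocalSection

/-! ### The local section and the homeomorphism. -/

theorem mainTheorem2 {H : Type*} [NormedAddCommGroup H] [InnerProductSpace ℂ H] [CompleteSpace H]
    (ρ : HermitianTraceClass H)
    (hρ : FiniteDimensional ℂ (LinearMap.range (ρ.toOp : H →ₗ[ℂ] H))) :
    (∃ W : Set (MulAction.orbit (unitary (H →L[ℂ] H)) ρ),
      IsOpen W ∧ (⟨ρ, MulAction.mem_orbit_self ρ⟩ : MulAction.orbit (unitary (H →L[ℂ] H)) ρ) ∈ W ∧
      (∀ σ ∈ W, projDist ρ.toOp σ.1.toOp ≤ 1 / 2) ∧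
      ∃ Φ : W → unitary (H →L[ℂ] H),
        (∀ σ : W, IsPolarUnitary (projSum ρ.toOp σ.1.1.toOp) (Φ σ)) ∧
        Topology.IsEmbedding Φ ∧
        ∀ σ : W, (QuotientGroup.mk (Φ σ) :
          unitary (H →L[ℂ] H) ⧸ MulAction.stabilizer (unitary (H →L[ℂ] H)) ρ)
            = orbitEquivQuotient ρ σ.1) ∧
    IsHomeomorph (orbitEquivQuotient ρ) := by
  let o : MulAction.orbit (unitary (H →L[ℂ] H)) ρ := ⟨ρ, MulAction.mem_orbit_self ρ⟩
  -- The strict inequality makes `W` open.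
  let W : Set (MulAction.orbit (unitary (H →L[ℂ] H)) ρ) :=
    {σ | projDist ρ.toOp σ.1.toOp < 1 / 2}
  have hW : IsOpen W := isOpen_lt (continuous_projDist_orbit ρ) continuous_const
  have hoW : o ∈ W := by
    change projDist ρ.toOp ρ.toOp < 1 / 2
    rw [projDist_self]
    norm_num
  have hunit : ∀ σ : W, IsUnit (projSum ρ.toOp σ.1.1.toOp) := fun σ =>
    isUnit_projSum ρ.isSelfAdjoint (lt_trans σ.2 (by norm_num))
  let Φ : W → unitary (H →L[ℂ] H) := fun σ => polarUnitary _ (hunit σ)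
  have hΦ : Continuous Φ :=
    continuous_polarUnitary ((continuous_projSum_orbit ρ).comp continuous_subtype_val) hunit
  have hsec : ∀ σ : W, Φ σ • ρ = σ.1.1 := fun σ => HermitianTraceClass.ext
    (polarUnitary_conj (hunit σ) ρ.isSelfAdjoint σ.1.1.isSelfAdjoint
      (projSum_mul _ ρ.isSelfAdjoint))
  have hmk : ∀ σ : W, (QuotientGroup.mk (Φ σ) :
      unitary (H →L[ℂ] H) ⧸ MulAction.stabilizer (unitary (H →L[ℂ] H)) ρ)
        = orbitEquivQuotient ρ σ.1 := fun σ => mk_eq_orbitEquivQuotient ρ (hsec σ)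
  have hg : Continuous fun U : unitary (H →L[ℂ] H) => U • o :=
    (continuous_smul_orbit ρ).comp (Continuous.prodMk continuous_id continuous_const)
  have hemb : Topology.IsEmbedding Φ := by
    -- The orbit map composed with `Φ` is the inclusion of `W`.
    refine Topology.IsEmbedding.of_comp hΦ hg ?_
    have : (fun U : unitary (H →L[ℂ] H) => U • o) ∘ Φ = Subtype.val :=
      funext fun σ => Subtype.ext (hsec σ)
    rw [this]
    exact Topology.IsEmbedding.subtypeVal
  refine ⟨⟨W, hW, hoW, fun σ hσ => le_of_lt hσ, Φ,
    fun σ => isPolarUnitary_polarUnitary (hunit σ), hemb, hmk⟩, ?_⟩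
  have hco : ContinuousAt (orbitEquivQuotient ρ) o := by
    refine ContinuousOn.continuousAt ?_ (hW.mem_nhds hoW)
    rw [continuousOn_iff_continuous_domRestrict]
    exact (QuotientGroup.continuous_mk.comp hΦ).congr hmk
  have hc : Continuous (orbitEquivQuotient ρ) := by
    refine continuous_iff_continuousAt.2 fun σ => ?_
    obtain ⟨U, hU⟩ : ∃ U : unitary (H →L[ℂ] H), U • o = σ := by
      obtain ⟨U, hU⟩ := σ.2
      exact ⟨U, Subtype.ext hU⟩
    have hUσ : U⁻¹ • σ = o := by rw [← hU, inv_smul_smul]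
    -- By equivariance the map is its own conjugate under `U`, which moves continuity from `o` to
    -- `σ`.
    have heq : (orbitEquivQuotient ρ : _ → _)
        = (fun q => U • q) ∘ orbitEquivQuotient ρ ∘ fun τ => U⁻¹ • τ := by
      funext τ
      simp only [Function.comp_apply]
      rw [orbitEquivQuotient_smul, smul_inv_smul]
    rw [heq]
    refine (continuous_const_smul U).continuousAt.comp (ContinuousAt.comp ?_ ?_)
    · rwa [hUσ]
    · exact ((continuous_smul_orbit ρ).comp
        (Continuous.prodMk continuous_const continuous_id)).continuousAt
  exact Homeomorph.isHomeomorph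
    { orbitEquivQuotient ρ with
      continuous_toFun := hc
      continuous_invFun := continuous_orbitEquivQuotient_symm ρ }
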